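/- A function $f:\mathbb{R}^d\to\mathbb{R}$ is $L$-smooth if it is differentiable with $\|\nabla f(x)-\nabla f(y)\|\le L\|x-y\|$ for all $x,y$, and $\mu$-PL if $\|\nabla f(x)\|^2\ge 2\mu\,(f(x)-f^*)$ for all $x$, where $f^*=\inf f$. Fix initial points $x^{(0)}=x^{(0)}_d\in\mathbb{R}^d$, one for each dimension $d$, and let $\mathcal P(\Delta,\mu,L)$ be the class of all $L$-smooth, $\mu$-PL functions $f$ on some $\mathbb{R}^d$, $d$ arbitrary, that have a minimizer and satisfy $f(x^{(0)})-f^*\le\Delta$. Let $\mathcal A^{(1)}$ be the class of deterministic first-order algorithms $\mathsf A$ started at $x^{(0)}$: on every differentiable $f:\mathbb{R}^d\to\mathbb{R}$ the algorithm produces a sequence $x^{(0)},x^{(1)},\dots$ in $\mathbb{R}^d$ with $x^{(i)}=\mathsf A^{(i)}\big(x^{(0)},\nabla f(x^{(0)}),\dots,x^{(i-1)},\nabla f(x^{(i-1)})\big)$ for $i\ge1$, where the rule $\mathsf A^{(i)}$ may depend on $d$ and $i$ but not on $f$. Put $T_\varepsilon(\mathsf A,f)=\min\{t:f(x^{(t)})-f^*\le\varepsilon\}$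 (with value $\infty$ if there is no such $t$), and $$\mathsf T_\varepsilon(\mathsf A,\mathcal F)=\sup_{f\in\mathcal F}T_\varepsilon(\mathsf A,f),\qquad \mathcal T_\varepsilon(\mathcal A,\mathcal F)=\inf_{\mathsf A\in\mathcal A}\ \sup_{f\in\mathcal F}T_\varepsilon(\mathsf A,f).$$ **Theorem.** There are universal constants $K\ge1$ and $c,C>0$ such that for all $\mu>0$, all $L$ with $\kappa=L/\mu\ge K$, all $\Delta$ and $\varepsilon$ with $0<\varepsilon\le\Delta/16$, and all initial points, $$\mathcal T_\varepsilon\big(\mathcal A^{(1)},\mathcal P(\Delta,\mu,L)\big)\ \ge\ c\,\kappa\log\frac{\Delta}{\varepsilon}.$$ Moreover, Gradient Descent $x^{(k+1)}=x^{(k)}-\frac1L\nabla f(x^{(k)})$ (written $\mathsf{GD}$), which belongs to $\mathcal A^{(1)}$, is optimal up to a constant factor: $$\mathsf T_\varepsilon\big(\mathsf{GD},\mathcal P(\Delta,\mu,L)\big)\le C\,\kappa\log\frac{\Delta}{\varepsilon}\quad\text{and}\quad \mathsf T_\varepsilon\big(\mathsf{GD},\mathcal P(\Delta,\mu,L)\big)\le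 C\;\mathcal T_\varepsilon\big(\mathcal A^{(1)},\mathcal P(\Delta,\mu,L)\big).$$ In particular, for each fixed $\Delta>0$ there is $c_\Delta>0$, depending only on $\Delta$, such that $\mathcal T_\varepsilon(\mathcal A^{(1)},\mathcal P(\Delta,\mu,L))\ge c_\Delta\,\kappa\log\frac1\varepsilon$ whenever $\mu>0$, $\kappa=L/\mu\ge K$ and $0<\varepsilon\le\Delta/16$, for all initial points. -/

import Mathlib

open scoped ENNReal

noncomputable section

namespace PLBound

/-- The Euclidean space `ℝ^d`. -/
abbrev E (d : ℕ) : Type := EuclideanSpace ℝ (Fin d)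

/-- `f* = inf f`. It is only used for functions that attain their minimum. -/
def optValue {d : ℕ} (f : E d → ℝ) : ℝ := ⨅ y, f y

/-- `f` is differentiable and its gradient is `L`-Lipschitz. -/
def IsSmooth {d : ℕ} (L : ℝ) (f : E d → ℝ) : Prop :=
  Differentiable ℝ f ∧ ∀ x y, ‖gradient f x - gradient f y‖ ≤ L * ‖x - y‖

/-- The `μ`-Polyak–Łojasiewicz condition. -/
def IsPL {d : ℕ} (μ : ℝ) (f : E d → ℝ) : Prop :=
  ∀ x, 2 * μ * (f x - optValue f) ≤ ‖gradient f x‖ ^ 2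

/-- The class `P(Δ, μ, L)` in every dimension `d`, for the initial points `x₀ d ∈ ℝ^d`: all
`L`-smooth and `μ`-PL functions that have a minimizer and satisfy `f (x₀ d) - f* ≤ Δ`. -/
def plClass (x₀ : (d : ℕ) → E d) (Δ μ L : ℝ) (d : ℕ) : Set (E d → ℝ) :=
  {f | IsSmooth L f ∧ IsPL μ f ∧ (∃ z, ∀ y, f z ≤ f y) ∧ f (x₀ d) - optValue f ≤ Δ}

/-- A (deterministic, dimension-free) algorithm maps a function on any `ℝ^d` to a sequence of
points of `ℝ^d`. -/
abbrev Algorithm : Type := (d : ℕ) → (E d → ℝ) → ℕ → E d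

/-- The first-order algorithms started at `x₀`: on differentiable functions, the first point is
`x₀ d`, and each later point is a function of the previous points and of the gradients of `f` at
them. The rule may depend on the dimension and on the iteration, not on `f`. -/
def firstOrder (x₀ : (d : ℕ) → E d) : Set Algorithm :=
  {A | ∃ step : (d n : ℕ) → (Fin (n + 1) → E d × E d) → E d,
    ∀ (d : ℕ) (f : E d → ℝ), Differentiable ℝ f →
      A d f 0 = x₀ d ∧
      ∀ n, A d f (n + 1) = step d n (fun j => (A d f j, gradient f (A d f j)))}

/-- `T_ε(A, f)`: the least `t` such that `x^t` is an `ε`-approximate optimal point, that is, the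
number of gradient queries made before such a point is found; `⊤` if there is none. -/
def complexity (ε : ℝ) (A : Algorithm) {d : ℕ} (f : E d → ℝ) : ℕ∞ :=
  ⨅ (t : ℕ) (_ : f (A d f t) - optValue f ≤ ε), (t : ℕ∞)

/-- `T_ε(A, F) = sup_{f ∈ F} T_ε(A, f)`, over functions of any dimension. -/
def worstComplexity (ε : ℝ) (A : Algorithm) (F : (d : ℕ) → Set (E d → ℝ)) : ℕ∞ :=
  ⨆ (d : ℕ) (f ∈ F d), complexity ε A f

/-- `T_ε(𝒜, F) = inf_{A ∈ 𝒜} sup_{f ∈ F} T_ε(A, f)`. -/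
def minimaxComplexity (ε : ℝ) (𝒜 : Set Algorithm) (F : (d : ℕ) → Set (E d → ℝ)) : ℕ∞ :=
  ⨅ A ∈ 𝒜, worstComplexity ε A F

/-- Gradient Descent with constant step size `1 / L`, started at `x₀`. -/
def gradientDescent (x₀ : (d : ℕ) → E d) (L : ℝ) : Algorithm
  | d, _, 0 => x₀ d
  | d, f, n + 1 =>
      gradientDescent x₀ L d f n - (1 / L) • gradient f (gradientDescent x₀ L d f n)

end PLBound

end

open scoped ENNReal

namespace PLBound

/-! The lower bound uses a chain of scalar coordinates `z 1, …, z N` with `z 0 = 0`, the links `(z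
(j+1) - a * z j)² / 2` and, at each coordinate, a well whose minimum is `0` but whose derivative
also vanishes at the profile value `r * a ^ j`. The start puts every coordinate on the profile. Only
the first, clamped link is stretched there, so the gradient shows a single direction; each further
query shows at most one more. The directions can be chosen adversarially and orthogonally to
everything queried so far (`gradient_chain_congr`, `exists_resisting_directions`). After `t` queries
the coordinates beyond `t` still sit on the profile and cost about `a ^ (2 * t)` of the initial gap,
so `log (Δ / ε) / (1 - a ^ 2)` queries are needed up to a constant.

The crux is that the chain is PL with constant of order `σ * (1 - a ^ 2)` although each well has a
spurious critical point (`sum_sq_le_sum_chainForce`). Call an index far if `z j` is not within a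
tenth of the profile. At a far index the well is quadratic and its force controls `z j`; at a near
index with a far neighbour the stretched link produces a force. Any other near index lies in a run
that starts just right of a far index, because index `0` is always far. Along the run the profile
decays by `a`, so its energy is at most a geometric series, with ratio `a ^ 2`, of energy already
controlled. Since smoothness is of order `σ`, `κ` is of order `1 / (1 - a ^ 2)`.

The upper bound is the descent lemma combined with PL: each gradient step contracts the gap by `1 -
μ / L`. -/

/-! ### The scalar well. -/

/-- A tent of height `y` centred at `y`, of half-width `y / 10`. -/
def tent (y x : ℝ) : ℝ := max 0 (y - 10 * |x - y|)

/-- The derivative of the nonconvex potential `well y`. -/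
def wellDeriv (y x : ℝ) : ℝ := 30 * (x - tent y x)

/-- A potential on the line, minimal at `0`, with a second critical point at `y`. -/
noncomputable def well (y x : ℝ) : ℝ := 15 * x ^ 2 - 30 * ∫ s in (0 : ℝ)..x, tent y s

lemma tent_nonneg (y x : ℝ) : 0 ≤ tent y x := le_max_left _ _

lemma tent_self {y : ℝ} (hy : 0 < y) : tent y y = y := by
  simp [tent, hy.le]

lemma tent_le {y x : ℝ} (hy : 0 < y) : tent y x ≤ y :=
  max_le hy.le (by linarith [abs_nonneg (x - y)])

lemma tent_eq_zero {y x : ℝ} (h : y / 10 ≤ |x - y|) : tent y x = 0 :=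
  max_eq_left (by linarith)

/-- This keeps the well nondecreasing on `x ≥ 0`: its second critical point is not a local minimum.
-/
lemma tent_le_self {y x : ℝ} (hx : 0 ≤ x) : tent y x ≤ x :=
  max_le hx (by linarith [abs_nonneg (x - y), neg_abs_le (x - y)])

lemma tent_eq_zero_of_le {y x : ℝ} (hx : x ≤ 9 / 10 * y) : tent y x = 0 :=
  tent_eq_zero (by linarith [neg_abs_le (x - y)])

lemma continuous_tent (y : ℝ) : Continuous (tent y) := by
  unfold tent; fun_prop

lemma abs_tent_sub_le (y x x' : ℝ) : |tent y x - tent y x'| ≤ 10 * |x - x'| := by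
  have h := abs_max_sub_max_le_max 0 (y - 10 * |x - y|) 0 (y - 10 * |x' - y|)
  have h2 : |y - 10 * |x - y| - (y - 10 * |x' - y|)| ≤ 10 * |x - x'| := by
    have := abs_abs_sub_abs_le (x' - y) (x - y)
    rw [show y - 10 * |x - y| - (y - 10 * |x' - y|) = 10 * (|x' - y| - |x - y|) by ring,
      abs_mul, abs_of_pos (by norm_num : (0 : ℝ) < 10)]
    rw [show x' - y - (x - y) = x' - x by ring, abs_sub_comm x' x] at this
    linarith
  refine h.trans (max_le ?_ h2)
  simp

lemma abs_wellDeriv_sub_le (y x x' : ℝ) :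
    |wellDeriv y x - wellDeriv y x'| ≤ 330 * |x - x'| := by
  have h := abs_tent_sub_le y x x'
  rw [abs_le] at h ⊢
  unfold wellDeriv
  constructor <;> nlinarith [neg_abs_le (x - x'), le_abs_self (x - x'), h.1, h.2]

lemma wellDeriv_self {y : ℝ} (hy : 0 < y) : wellDeriv y y = 0 := by
  simp [wellDeriv, tent_self hy]

lemma wellDeriv_nonneg {y x : ℝ} (hx : 0 ≤ x) : 0 ≤ wellDeriv y x := by
  have := tent_le_self (y := y) hx
  unfold wellDeriv; linarith

lemma wellDeriv_eq {y x : ℝ} (h : y / 10 ≤ |x - y|) : wellDeriv y x = 30 * x := by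
  simp [wellDeriv, tent_eq_zero h]

lemma hasDerivAt_well (y x : ℝ) : HasDerivAt (well y) (wellDeriv y x) x := by
  have h := ((continuous_tent y).integral_hasStrictDerivAt 0 x).hasDerivAt
  have h2 := (((hasDerivAt_id x).pow 2).const_mul 15).sub (h.const_mul 30)
  refine h2.congr_deriv ?_
  simp [wellDeriv]; ring

lemma integral_tent_eq_zero {y x : ℝ} (hy : 0 < y) (hx : x ≤ 9 / 10 * y) :
    ∫ s in (0 : ℝ)..x, tent y s = 0 := by
  have : ∫ s in (0 : ℝ)..x, tent y s = ∫ s in (0 : ℝ)..x, (0 : ℝ) := by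
    refine intervalIntegral.integral_congr fun s hs => tent_eq_zero_of_le ?_
    rw [Set.mem_uIcc] at hs
    rcases hs with hs | hs <;> linarith [hs.2]
  simpa using this

lemma integral_tent_nonneg {y : ℝ} (hy : 0 < y) (x : ℝ) :
    0 ≤ ∫ s in (0 : ℝ)..x, tent y s := by
  rcases le_total 0 x with hx | hx
  · exact intervalIntegral.integral_nonneg hx fun s _ => tent_nonneg y s
  · exact (integral_tent_eq_zero hy (by linarith)).ge

lemma well_le {y : ℝ} (hy : 0 < y) (x : ℝ) : well y x ≤ 15 * x ^ 2 := by
  have := integral_tent_nonneg hy x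
  unfold well; linarith

lemma well_nonneg {y : ℝ} (hy : 0 < y) (x : ℝ) : 0 ≤ well y x := by
  unfold well
  rcases le_total 0 x with hx | hx
  · have h : ∫ s in (0 : ℝ)..x, tent y s ≤ ∫ s in (0 : ℝ)..x, s :=
      intervalIntegral.integral_mono_on hx ((continuous_tent y).intervalIntegrable _ _)
        (continuous_id.intervalIntegrable _ _) fun s hs => tent_le_self hs.1
    rw [integral_id] at h
    nlinarith
  · rw [integral_tent_eq_zero hy (by linarith)]
    simp; positivity

lemma well_zero (y : ℝ) : well y 0 = 0 := by simp [well]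

/-- Left of `y` the tent lives on an interval of length `y / 10` with height at most `y`, so it
removes at most `3 * y ^ 2` from `15 * y ^ 2`. -/
lemma le_well_self {y : ℝ} (hy : 0 < y) : 12 * y ^ 2 ≤ well y y := by
  have hi : ∀ p q, IntervalIntegrable (tent y) MeasureTheory.volume p q :=
    fun p q => (continuous_tent y).intervalIntegrable p q
  have h1 := intervalIntegral.integral_add_adjacent_intervals (hi 0 (9 / 10 * y)) (hi (9 / 10 * y) y)
  have h2 : ∫ s in (9 / 10 * y)..y, tent y s ≤ ∫ s in (9 / 10 * y)..y, y :=
    intervalIntegral.integral_mono_on (by linarith) (hi _ _)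
      (continuous_const.intervalIntegrable _ _) fun s _ => tent_le hy
  rw [integral_tent_eq_zero hy le_rfl] at h1
  rw [intervalIntegral.integral_const, smul_eq_mul] at h2
  unfold well
  nlinarith

/-! ### The PL inequality for scalar chains. -/

/-- The derivative of `½ (z₁ - a z₀)² + ½ (z₂ - a z₁)² + well y z₁` in `z₁`. -/
def chainForce (a y z₀ z₁ z₂ : ℝ) : ℝ :=
  (z₁ - a * z₀) - a * (z₂ - a * z₁) + wellDeriv y z₁

/-- At a far index the force is linear, with slope at least `31` in `z₁`; the neighbours enter with
weight at most one. The margin `180 / 31 ^ 2 < 1 / 4` allows the later absorption. -/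
lemma far_sq_le {a y z₀ z₁ z₂ m₀ m₂ : ℝ} (ha0 : 0 ≤ a) (ha1 : a ≤ 1)
    (h : y / 10 ≤ |z₁ - y|) (h₀ : z₀ ^ 2 ≤ m₀) (h₂ : z₂ ^ 2 ≤ m₂) :
    60 * z₁ ^ 2 ≤ 15 * chainForce a y z₀ z₁ z₂ ^ 2 + (m₀ + m₂) / 4 := by
  set e := chainForce a y z₀ z₁ z₂ with he
  have hz : (31 + a ^ 2) * z₁ = e + a * z₀ + a * z₂ := by
    rw [he, chainForce, wellDeriv_eq h]; ring
  have h3 : (e + a * z₀ + a * z₂) ^ 2 ≤ 3 * (e ^ 2 + (a * z₀) ^ 2 + (a * z₂) ^ 2) := by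
    nlinarith [sq_nonneg (e - a * z₀), sq_nonneg (e - a * z₂), sq_nonneg (a * z₀ - a * z₂)]
  have h4 : 31 ^ 2 * z₁ ^ 2 ≤ ((31 + a ^ 2) * z₁) ^ 2 := by
    rw [mul_pow]
    gcongr
    nlinarith
  have ha2 : a ^ 2 ≤ 1 := by nlinarith
  have h5 : (a * z₀) ^ 2 ≤ m₀ := by rw [mul_pow]; nlinarith [sq_nonneg z₀]
  have h6 : (a * z₂) ^ 2 ≤ m₂ := by rw [mul_pow]; nlinarith [sq_nonneg z₂]
  have h7 : 0 ≤ m₀ := (sq_nonneg _).trans h₀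
  have h8 : 0 ≤ m₂ := (sq_nonneg _).trans h₂
  rw [hz] at h4
  nlinarith [sq_nonneg e]

/-- A far neighbour either stretches its link, which pushes `z₁` with a force comparable to `y`, or
is itself large. The weight `60` on far energy makes the neighbour terms cost at most `1 / 4`. -/
lemma near_sq_le {a y₀ z₀ z₁ z₂ m₀ m₂ : ℝ} (ha0 : 9 / 10 ≤ a) (ha1 : a ≤ 1) (hy : 0 < y₀)
    (h : |z₁ - a * y₀| < a * y₀ / 10)
    (hm₀ : 0 ≤ m₀) (hm₂ : 0 ≤ m₂)
    (h₀ : y₀ / 10 ≤ |z₀ - y₀| → 60 * z₀ ^ 2 ≤ m₀)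
    (h₂ : a * (a * y₀) / 10 ≤ |z₂ - a * (a * y₀)| → 60 * z₂ ^ 2 ≤ m₂)
    (hor : y₀ / 10 ≤ |z₀ - y₀| ∨ a * (a * y₀) / 10 ≤ |z₂ - a * (a * y₀)|) :
    z₁ ^ 2 ≤ 15 * chainForce a (a * y₀) z₀ z₁ z₂ ^ 2 + (m₀ + m₂) / 4 := by
  set y := a * y₀ with hyy
  have hyp : 0 < y := by positivity
  set e := chainForce a y z₀ z₁ z₂ with he
  rw [abs_lt] at h
  have hz1 : 0 ≤ z₁ := by linarith
  have hw := wellDeriv_nonneg (y := y) hz1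
  have ha2 : a ^ 2 ≤ 1 := by nlinarith
  have ha3 : 81 / 100 ≤ a ^ 2 := by nlinarith
  -- `p` is `|z₀|` if the left neighbour is far and `0` if it is near; a near neighbour pulls back
  -- by at most `y / 5`. `q` plays the same role on the right.
  obtain ⟨p, hp0, hpm, hp⟩ : ∃ p, 0 ≤ p ∧ 60 * p ^ 2 ≤ m₀ ∧
      ((y / 10 * 9 - p ≤ z₁ - a * z₀) ∨ (p = 0 ∧ - (y / 5) ≤ z₁ - a * z₀ ∧
        ¬ y₀ / 10 ≤ |z₀ - y₀|)) := by
    by_cases hg : y₀ / 10 ≤ |z₀ - y₀|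
    · refine ⟨|z₀|, abs_nonneg _, by rw [sq_abs]; exact h₀ hg, Or.inl ?_⟩
      have : a * z₀ ≤ |z₀| := by nlinarith [le_abs_self z₀, abs_nonneg z₀]
      linarith
    · refine ⟨0, le_rfl, by simpa using hm₀, Or.inr ⟨rfl, ?_, hg⟩⟩
      rw [not_le, abs_lt] at hg
      have : a * z₀ ≤ a * (y₀ * (11 / 10)) := by gcongr; linarith
      linarith
  obtain ⟨q, hq0, hqm, hq⟩ : ∃ q, 0 ≤ q ∧ 60 * q ^ 2 ≤ m₂ ∧
      ((y * (729 / 1000) - q ≤ - (a * (z₂ - a * z₁))) ∨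
        (q = 0 ∧ - (y / 5) ≤ - (a * (z₂ - a * z₁)) ∧
        ¬ a * y / 10 ≤ |z₂ - a * y|)) := by
    by_cases hg : a * y / 10 ≤ |z₂ - a * y|
    · refine ⟨|z₂|, abs_nonneg _, by rw [sq_abs]; exact h₂ hg, Or.inl ?_⟩
      have : a * z₂ ≤ |z₂| := by nlinarith [le_abs_self z₂, abs_nonneg z₂]
      nlinarith
    · refine ⟨0, le_rfl, by simpa using hm₂, Or.inr ⟨rfl, ?_, hg⟩⟩
      rw [not_le, abs_lt] at hg
      have h1 : a * z₂ ≤ a * (a * y * (11 / 10)) := by gcongr; linarith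
      have h2 : a ^ 2 * (9 / 10 * y) ≤ a ^ 2 * z₁ := by gcongr; linarith
      nlinarith
  -- The well force is nonnegative and is dropped. The worst admissible case is a near left and a
  -- far right neighbour: `0.729 - 0.2 > 1 / 2`.
  have key : y * (1 / 2) ≤ e + p + q := by
    have hee : e = (z₁ - a * z₀) + - (a * (z₂ - a * z₁)) + wellDeriv y z₁ := by
      rw [he, chainForce]; ring
    rcases hp with hp | ⟨hp1, hp2, hp3⟩ <;> rcases hq with hq | ⟨hq1, hq2, hq3⟩
    · linarith
    · linarith
    · linarith
    · exact absurd hor (not_or.mpr ⟨hp3, hq3⟩)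
  have h1 : z₁ ≤ 11 / 5 * (e + p + q) := by linarith
  have h2 : z₁ ^ 2 ≤ (11 / 5 * (e + p + q)) ^ 2 := by gcongr
  have h3 : (e + p + q) ^ 2 ≤ 3 * (e ^ 2 + p ^ 2 + q ^ 2) := by
    nlinarith [sq_nonneg (e - p), sq_nonneg (e - q), sq_nonneg (p - q)]
  nlinarith [sq_nonneg e]

open Classical in
/-- The part of the energy `∑ z j ^ 2` that sits at, or next to, the indices at which `z` is far
from `y`. -/
noncomputable def farEnergy (y z : ℕ → ℝ) : ℕ → ℝ
  | 0 => 0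
  | j + 1 =>
    if y (j + 1) / 10 ≤ |z (j + 1) - y (j + 1)| then 60 * z (j + 1) ^ 2
    else if y j / 10 ≤ |z j - y j| ∨ y (j + 2) / 10 ≤ |z (j + 2) - y (j + 2)| then z (j + 1) ^ 2
    else 0

lemma farEnergy_nonneg (y z : ℕ → ℝ) (j : ℕ) : 0 ≤ farEnergy y z j := by
  cases j with
  | zero => exact le_rfl
  | succ j => rw [farEnergy]; split_ifs <;> positivity

lemma farEnergy_of_far {y z : ℕ → ℝ} (z0 : z 0 = 0) {j : ℕ} (h : y j / 10 ≤ |z j - y j|) :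
    60 * z j ^ 2 = farEnergy y z j := by
  cases j with
  | zero => simp [farEnergy, z0]
  | succ j => simp only [farEnergy, if_pos h]

lemma sq_le_farEnergy {y z : ℕ → ℝ} {j : ℕ}
    (h : y j / 10 ≤ |z j - y j|) : z (j + 1) ^ 2 ≤ farEnergy y z (j + 1) := by
  rw [farEnergy]
  split_ifs with h1 h2
  · nlinarith [sq_nonneg (z (j + 1))]
  · exact le_rfl
  · exact absurd (Or.inl h) h2

lemma sq_le_farEnergy_left {y z : ℕ → ℝ} (z0 : z 0 = 0) {j : ℕ}
    (h : y (j + 1) / 10 ≤ |z (j + 1) - y (j + 1)|) : z j ^ 2 ≤ farEnergy y z j := by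
  cases j with
  | zero => simp [z0, farEnergy]
  | succ j =>
    rw [farEnergy]
    split_ifs with h1 h2
    · nlinarith [sq_nonneg (z (j + 1))]
    · exact le_rfl
    · exact absurd (Or.inr h) h2

lemma farEnergy_succ_le {a : ℝ} (ha0 : 9 / 10 ≤ a) (ha1 : a ≤ 1) {y z : ℕ → ℝ}
    (hy : ∀ j, 0 < y j) (hya : ∀ j, y (j + 1) = a * y j) (z0 : z 0 = 0) (j : ℕ) :
    farEnergy y z (j + 1) ≤ 15 * chainForce a (y (j + 1)) (z j) (z (j + 1)) (z (j + 2)) ^ 2 +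
      (farEnergy y z j + farEnergy y z (j + 2)) / 4 := by
  have n0 := farEnergy_nonneg y z j
  have n2 := farEnergy_nonneg y z (j + 2)
  rw [farEnergy]
  split_ifs with h1 h2
  · exact far_sq_le (by linarith) ha1 h1 (sq_le_farEnergy_left z0 h1) (sq_le_farEnergy h1)
  · have h20 := hya (j + 1)
    rw [hya j] at h1 h20 ⊢
    rw [h20] at h2
    refine near_sq_le ha0 ha1 (hy j) (not_le.mp h1) n0 n2
      (fun h => (farEnergy_of_far z0 h).le) (fun h => (farEnergy_of_far z0 ?_).le) h2
    rw [h20]; exact h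
  · positivity

/-- The energy of a sequence that follows the profile `y` geometrically is controlled by the forces
on it: this is the Polyak–Łojasiewicz inequality for the chain. -/
lemma sum_sq_le_sum_chainForce {a : ℝ} (ha0 : 9 / 10 ≤ a) (ha1 : a < 1) {y z : ℕ → ℝ} {N : ℕ}
    (hy : ∀ j, 0 < y j) (hya : ∀ j, y (j + 1) = a * y j) (z0 : z 0 = 0)
    (hz : ∀ j, N ≤ j → z (j + 1) = a * z j) :
    (1 - a ^ 2) * ∑ j ∈ Finset.range N, z (j + 1) ^ 2 ≤
      180 * ∑ j ∈ Finset.range N,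
        chainForce a (y (j + 1)) (z j) (z (j + 1)) (z (j + 2)) ^ 2 := by
  set M := farEnergy y z with hM
  set e : ℕ → ℝ := fun j => chainForce a (y (j + 1)) (z j) (z (j + 1)) (z (j + 2)) with he
  have hM0 : ∀ j, 0 ≤ M j := farEnergy_nonneg y z
  have hfar : ∀ j, N ≤ j → (y (j + 1) / 10 ≤ |z (j + 1) - y (j + 1)| ↔ y j / 10 ≤ |z j - y j|) := by
    intro j hj
    rw [hz j hj, hya j, ← mul_sub, abs_mul, abs_of_pos (by linarith : 0 < a), mul_div_assoc]
    exact mul_le_mul_iff_of_pos_left (by linarith)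
  -- Beyond `N` both `z` and `y` are geometric with ratio `a`, so far or near status no longer
  -- changes.
  have hend : M (N + 1) ≤ M N := by
    by_cases h : y N / 10 ≤ |z N - y N|
    · rw [hM, ← farEnergy_of_far z0 h, ← farEnergy_of_far z0 ((hfar N le_rfl).mpr h), hz N le_rfl]
      have : a ^ 2 ≤ 1 := by nlinarith
      nlinarith [sq_nonneg (z N)]
    · have h1 := mt (hfar N le_rfl).mp h
      have h2 := mt (hfar (N + 1) (by omega)).mp h1
      have : M (N + 1) = 0 := by
        rw [hM, farEnergy, if_neg h1, if_neg (not_or.mpr ⟨h, h2⟩)]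
      rw [this]; exact hM0 N
  -- Each of the two neighbour sums is bounded by the sum `S` of `M`, up to a boundary term: `S ≤ 15
  -- ∑ e² + (S + 2 S) / 4`, and the last term is absorbed.
  have hsum : ∑ j ∈ Finset.range N, M (j + 1) ≤ 60 * ∑ j ∈ Finset.range N, e j ^ 2 := by
    have h1 : ∑ j ∈ Finset.range N, M (j + 1) ≤
        ∑ j ∈ Finset.range N, (15 * e j ^ 2 + (M j + M (j + 2)) / 4) :=
      Finset.sum_le_sum fun j _ => farEnergy_succ_le ha0 ha1.le hy hya z0 j
    rw [Finset.sum_add_distrib, ← Finset.mul_sum, ← Finset.sum_div, Finset.sum_add_distrib] at h1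
    have hM00 : M 0 = 0 := rfl
    have h2 : ∑ j ∈ Finset.range N, M j ≤ ∑ j ∈ Finset.range N, M (j + 1) := by
      have e1 := Finset.sum_range_succ M N
      have e2 := Finset.sum_range_succ' M N
      linarith [hM0 N]
    have h3 : ∑ j ∈ Finset.range N, M (j + 2) ≤ 2 * ∑ j ∈ Finset.range N, M (j + 1) := by
      have e1 := Finset.sum_range_succ (fun j => M (j + 1)) N
      have e2 := Finset.sum_range_succ' (fun j => M (j + 1)) N
      have e3 : M N ≤ ∑ j ∈ Finset.range N, M (j + 1) := by
        rcases N with _ | n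
        · simp [hM00]
        · exact Finset.single_le_sum (f := fun j => M (j + 1)) (fun j _ => hM0 _)
            (Finset.self_mem_range_succ n)
      simp only [zero_add] at e2
      linarith [hM0 1]
    linarith
  -- `U j` is the discounted sum of `M i * a ^ (2 * (j - i))` over `1 ≤ i ≤ j`: the energy
  -- transported along near runs.
  have hrec : ∃ U : ℕ → ℝ, U 0 = 0 ∧ ∀ j, U (j + 1) = M (j + 1) + a ^ 2 * U j :=
    ⟨fun j => Nat.rec 0 (fun k u => M (k + 1) + a ^ 2 * u) j, rfl, fun _ => rfl⟩
  obtain ⟨U, hU0, hU⟩ := hrec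
  have hUn : ∀ j, 0 ≤ U j := by
    intro j
    induction j with
    | zero => exact hU0.ge
    | succ j ih => rw [hU]; have := hM0 (j + 1); positivity
  -- Induction along a near run: it cannot start at `0`, its first index has energy in `M`, and each
  -- later step multiplies both sides by `a ^ 2`.
  have hyU : ∀ j, |z j - y j| < y j / 10 → y j ^ 2 ≤ 2 * U j := by
    intro j
    induction j with
    | zero =>
      intro h
      rw [z0, zero_sub, abs_neg, abs_of_pos (hy 0)] at h
      linarith [hy 0]
    | succ j ih =>
      intro h
      rw [hU]
      by_cases hj : y j / 10 ≤ |z j - y j|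
      · have h1 := sq_le_farEnergy (y := y) hj
        have h2 := hUn j
        rw [abs_lt] at h
        have h3 : (9 / 10 * y (j + 1)) ^ 2 ≤ z (j + 1) ^ 2 := by
          have := hy (j + 1)
          gcongr; linarith
        have h4 : 0 ≤ a ^ 2 * U j := by positivity
        rw [hM]
        nlinarith [sq_nonneg (y (j + 1))]
      · have h1 := ih (not_le.mp hj)
        rw [hya j, mul_pow]
        nlinarith [hM0 (j + 1), sq_nonneg a]
  have hzU : ∀ j, z (j + 1) ^ 2 ≤ 3 * U (j + 1) := by
    intro j
    by_cases h : y (j + 1) / 10 ≤ |z (j + 1) - y (j + 1)|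
    · have h1 := farEnergy_of_far z0 h
      rw [hU]
      have h2 : 0 ≤ a ^ 2 * U j := by have := hUn j; positivity
      nlinarith [sq_nonneg (z (j + 1))]
    · have h1 := hyU _ (not_le.mp h)
      rw [not_le, abs_lt] at h
      have h3 : z (j + 1) ^ 2 ≤ (11 / 10 * y (j + 1)) ^ 2 := by
        have := hy (j + 1)
        gcongr <;> linarith
      nlinarith [sq_nonneg (y (j + 1))]
  have hUs : (1 - a ^ 2) * ∑ j ∈ Finset.range N, U (j + 1) ≤ ∑ j ∈ Finset.range N, M (j + 1) := by
    have h1 : ∑ j ∈ Finset.range N, U (j + 1) =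
        ∑ j ∈ Finset.range N, M (j + 1) + a ^ 2 * ∑ j ∈ Finset.range N, U j := by
      rw [Finset.mul_sum, ← Finset.sum_add_distrib]
      exact Finset.sum_congr rfl fun j _ => hU j
    have h2 : ∑ j ∈ Finset.range N, U j ≤ ∑ j ∈ Finset.range N, U (j + 1) := by
      have e1 := Finset.sum_range_succ U N
      have e2 := Finset.sum_range_succ' U N
      linarith [hUn N]
    nlinarith [sq_nonneg a]
  have hzs : ∑ j ∈ Finset.range N, z (j + 1) ^ 2 ≤ 3 * ∑ j ∈ Finset.range N, U (j + 1) := by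
    rw [Finset.mul_sum]
    exact Finset.sum_le_sum fun j _ => hzU j
  have ha2 : 0 ≤ 1 - a ^ 2 := by nlinarith
  calc (1 - a ^ 2) * ∑ j ∈ Finset.range N, z (j + 1) ^ 2
      ≤ (1 - a ^ 2) * (3 * ∑ j ∈ Finset.range N, U (j + 1)) := by gcongr
    _ = 3 * ((1 - a ^ 2) * ∑ j ∈ Finset.range N, U (j + 1)) := by ring
    _ ≤ 3 * (60 * ∑ j ∈ Finset.range N, e j ^ 2) := by linarith
    _ = _ := by ring

/-! ### The hard function: gradient, smoothness, PL and values. -/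

lemma sum_mul_shift (N : ℕ) (D η : ℕ → ℝ) (h0 : η 0 = 0) :
    ∑ j ∈ Finset.range N, D j * η j =
      ∑ j ∈ Finset.range N, (if j + 1 < N then D (j + 1) else 0) * η (j + 1) := by
  rcases N with _ | N
  · simp
  · rw [Finset.sum_range_succ', Finset.sum_range_succ _ N]
    simp only [h0, mul_zero, add_zero, lt_self_iff_false, if_false, zero_mul]
    refine Finset.sum_congr rfl fun j hj => ?_
    rw [if_pos (by simpa using hj)]

lemma norm_sum_smul_sq {d N : ℕ} {u : ℕ → E d} (hu : Orthonormal ℝ (fun i : Fin N => u i))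
    (c : ℕ → ℝ) :
    ‖∑ j ∈ Finset.range N, c j • u j‖ ^ 2 = ∑ j ∈ Finset.range N, c j ^ 2 := by
  rw [Finset.sum_range, Finset.sum_range, ← real_inner_self_eq_norm_sq,
    hu.inner_sum (fun i => c i) (fun i => c i)]
  simp [sq]

lemma sum_inner_sq_le {d N : ℕ} {u : ℕ → E d} (hu : Orthonormal ℝ (fun i : Fin N => u i))
    (x : E d) : ∑ j ∈ Finset.range N, inner ℝ (u j) x ^ 2 ≤ ‖x‖ ^ 2 := by
  have := hu.sum_inner_products_le x (s := Finset.univ)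
  simpa [Finset.sum_range] using this

/-- The geometric profile that a chain starts from. -/
def profile (r a : ℝ) (j : ℕ) : ℝ := r * a ^ j

/-- The coordinates of a point in the chain along the directions `u`: it is clamped at `0` at the
left end, and it sits at the profile at the point `p`. -/
noncomputable def coord {d : ℕ} (r a : ℝ) (p : E d) (u : ℕ → E d) (x : E d) : ℕ → ℝ
  | 0 => 0
  | j + 1 => profile r a (j + 1) + inner ℝ (u j) (x - p)

/-- The hard function: a chain of `N` coordinates, each in a well with an additional critical
point at the profile. -/
noncomputable def chain {d : ℕ} (σ r a : ℝ) (N : ℕ) (p : E d) (u : ℕ → E d) (x : E d) : ℝ :=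
  σ * (∑ j ∈ Finset.range N, (coord r a p u x (j + 1) - a * coord r a p u x j) ^ 2 / 2 +
    ∑ j ∈ Finset.range N, well (profile r a (j + 1)) (coord r a p u x (j + 1)))

/-- The coefficients of the gradient of `chain` along the directions `u`, up to scaling. -/
noncomputable def chainCoeff (r a : ℝ) (N : ℕ) (z : ℕ → ℝ) (j : ℕ) : ℝ :=
  chainForce a (profile r a (j + 1)) (z j) (z (j + 1))
    (if j + 1 < N then z (j + 2) else a * z (j + 1))

lemma profile_pos {r a : ℝ} (hr : 0 < r) (ha : 0 < a) (j : ℕ) : 0 < profile r a j := by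
  unfold profile; positivity

lemma profile_succ (r a : ℝ) (j : ℕ) : profile r a (j + 1) = a * profile r a j := by
  unfold profile; ring

section

variable {d : ℕ} {σ r a : ℝ} {N : ℕ} {p : E d} {u : ℕ → E d}

lemma hasFDerivAt_coord (x : E d) (j : ℕ) :
    HasFDerivAt (fun x => coord r a p u x (j + 1)) (innerSL ℝ (u j)) x := by
  have h : HasFDerivAt (fun x : E d => innerSL ℝ (u j) (x - p)) (innerSL ℝ (u j)) x := by
    have := (innerSL ℝ (u j)).hasFDerivAt.comp x ((hasFDerivAt_id x).sub_const p)
    rw [ContinuousLinearMap.comp_id] at this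
    exact this
  exact h.const_add (profile r a (j + 1))

lemma hasGradientAt_chain (x : E d) :
    HasGradientAt (chain σ r a N p u)
      (σ • ∑ j ∈ Finset.range N, chainCoeff r a N (coord r a p u x) j • u j) x := by
  set z := coord r a p u x with hz
  let w : ℕ → (E d →L[ℝ] ℝ) := fun j => Nat.casesOn j 0 fun j => innerSL ℝ (u j)
  have hw : ∀ j, HasFDerivAt (fun x => coord r a p u x j) (w j) x := by
    intro j
    cases j with
    | zero => exact hasFDerivAt_const 0 x
    | succ j => exact hasFDerivAt_coord x j
  have h1 : ∀ j, HasFDerivAt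
      (fun x => (coord r a p u x (j + 1) - a * coord r a p u x j) ^ 2 / 2)
      ((z (j + 1) - a * z j) • (w (j + 1) - a • w j)) x := by
    intro j
    have h := ((hw (j + 1)).sub ((hw j).const_mul a))
    have h2 : HasDerivAt (fun t : ℝ => t ^ 2 / 2) (z (j + 1) - a * z j)
        (z (j + 1) - a * z j) := by
      refine (((hasDerivAt_id (z (j + 1) - a * z j)).pow 2).div_const 2).congr_deriv ?_
      simp
    exact h2.comp_hasFDerivAt x h
  have h2 : ∀ j, HasFDerivAt
      (fun x => well (profile r a (j + 1)) (coord r a p u x (j + 1)))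
      (wellDeriv (profile r a (j + 1)) (z (j + 1)) • w (j + 1)) x := fun j =>
    HasDerivAt.comp_hasFDerivAt (h₂ := well (profile r a (j + 1))) x (hasDerivAt_well _ _)
      (hw (j + 1))
  have h3 := ((HasFDerivAt.fun_sum fun j (_ : j ∈ Finset.range N) => h1 j).add
    (HasFDerivAt.fun_sum fun j (_ : j ∈ Finset.range N) => h2 j)).const_mul σ
  rw [hasGradientAt_iff_hasFDerivAt]
  refine HasFDerivAt.congr_fderiv h3 (ContinuousLinearMap.ext fun v => ?_)
  set η : ℕ → ℝ := fun j => w j v with hη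
  have hη1 : ∀ j, inner ℝ (u j) v = η (j + 1) := fun j => rfl
  -- Summation by parts moves the left half of each link onto the preceding coordinate; the last
  -- coordinate has no right link.
  have hs := sum_mul_shift N (fun j => z (j + 1) - a * z j) η rfl
  have h4 : ∑ j ∈ Finset.range N, (z (j + 1) - a * z j) * (η (j + 1) - a * η j) =
      ∑ j ∈ Finset.range N, (z (j + 1) - a * z j) * η (j + 1) -
        a * ∑ j ∈ Finset.range N, (z (j + 1) - a * z j) * η j := by
    rw [Finset.mul_sum, ← Finset.sum_sub_distrib]
    exact Finset.sum_congr rfl fun j _ => by ring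
  have h5 : ∑ j ∈ Finset.range N, chainCoeff r a N z j * η (j + 1) =
      ∑ j ∈ Finset.range N, (z (j + 1) - a * z j) * (η (j + 1) - a * η j) +
      ∑ j ∈ Finset.range N, wellDeriv (profile r a (j + 1)) (z (j + 1)) * η (j + 1) := by
    rw [h4, hs, Finset.mul_sum, ← Finset.sum_sub_distrib, ← Finset.sum_add_distrib]
    refine Finset.sum_congr rfl fun j _ => ?_
    unfold chainCoeff chainForce
    split_ifs <;> ring
  simp only [InnerProductSpace.toDual_apply_apply, inner_smul_left, sum_inner, conj_trivial,
    smul_apply, add_apply, sum_apply,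
    sub_apply, smul_eq_mul, hη1]
  rw [h5]

lemma gradient_chain (x : E d) : gradient (chain σ r a N p u) x =
    σ • ∑ j ∈ Finset.range N, chainCoeff r a N (coord r a p u x) j • u j :=
  (hasGradientAt_chain x).gradient

lemma differentiable_chain : Differentiable ℝ (chain σ r a N p u) :=
  fun x => (hasGradientAt_chain x).differentiableAt

lemma abs_chainForce_sub_le {y z₀ z₁ z₂ z₀' z₁' z₂' : ℝ} (ha0 : 0 ≤ a) (ha1 : a ≤ 1) :
    |chainForce a y z₀ z₁ z₂ - chainForce a y z₀' z₁' z₂'| ≤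
      |z₀ - z₀'| + 332 * |z₁ - z₁'| + |z₂ - z₂'| := by
  have h := abs_wellDeriv_sub_le y z₁ z₁'
  have e : chainForce a y z₀ z₁ z₂ - chainForce a y z₀' z₁' z₂' =
      (wellDeriv y z₁ - wellDeriv y z₁') + (1 + a ^ 2) * (z₁ - z₁') + -(a * (z₀ - z₀')) +
        -(a * (z₂ - z₂')) := by
    unfold chainForce; ring
  rw [e]
  refine (abs_add_le _ _).trans ?_
  have h1 := abs_add_le ((wellDeriv y z₁ - wellDeriv y z₁') + (1 + a ^ 2) * (z₁ - z₁'))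
    (-(a * (z₀ - z₀')))
  have h2 := abs_add_le (wellDeriv y z₁ - wellDeriv y z₁') ((1 + a ^ 2) * (z₁ - z₁'))
  rw [abs_neg, abs_mul, abs_of_nonneg ha0] at h1 ⊢
  rw [abs_mul (1 + a ^ 2), abs_of_nonneg (by positivity : 0 ≤ 1 + a ^ 2)] at h2
  have ha2 : a ^ 2 ≤ 1 := by nlinarith
  have h3 : (1 + a ^ 2) * |z₁ - z₁'| ≤ 2 * |z₁ - z₁'| := by gcongr; linarith
  have h4 : a * |z₀ - z₀'| ≤ 1 * |z₀ - z₀'| := by gcongr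
  have h5 : a * |z₂ - z₂'| ≤ 1 * |z₂ - z₂'| := by gcongr
  linarith

lemma sum_chainCoeff_sub_sq_le (ha0 : 0 ≤ a) (ha1 : a ≤ 1) {z z' : ℕ → ℝ} (h0 : z 0 = z' 0) :
    ∑ j ∈ Finset.range N, (chainCoeff r a N z j - chainCoeff r a N z' j) ^ 2 ≤
      600 ^ 2 * ∑ j ∈ Finset.range N, (z (j + 1) - z' (j + 1)) ^ 2 := by
  set δ : ℕ → ℝ := fun j => (z j - z' j) ^ 2 with hδ
  have hδ0 : δ 0 = 0 := by simp [hδ, h0]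
  have h1 : ∀ j ∈ Finset.range N, (chainCoeff r a N z j - chainCoeff r a N z' j) ^ 2 ≤
      -- `333` is `332` plus the `a ≤ 1` from the virtual right neighbour of the last coordinate.
      -- Summed, the factor is `3 * (333 ^ 2 + 2) ≤ 600 ^ 2`.
      3 * (δ j + 333 ^ 2 * δ (j + 1) + if j + 1 < N then δ (j + 2) else 0) := by
    intro j _
    unfold chainCoeff
    have hsq : ∀ t A B C : ℝ, 0 ≤ A → 0 ≤ B → 0 ≤ C → |t| ≤ A + B + C →
        t ^ 2 ≤ 3 * (A ^ 2 + B ^ 2 + C ^ 2) := by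
      intro t A B C hA hB hC h
      rw [← sq_abs t]
      have : |t| ^ 2 ≤ (A + B + C) ^ 2 := by gcongr
      nlinarith [sq_nonneg (A - B), sq_nonneg (A - C), sq_nonneg (B - C)]
    have ha2 : a * |z (j + 1) - z' (j + 1)| ≤ 1 * |z (j + 1) - z' (j + 1)| := by gcongr
    split_ifs with h
    · refine (hsq _ _ _ _ (abs_nonneg _) (by positivity) (abs_nonneg _)
        (abs_chainForce_sub_le ha0 ha1)).trans ?_
      rw [mul_pow, sq_abs, sq_abs, sq_abs]
      nlinarith [sq_nonneg (z (j + 1) - z' (j + 1))]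
    · refine (hsq _ |z j - z' j| (333 * |z (j + 1) - z' (j + 1)|) 0 (abs_nonneg _) (by positivity)
        le_rfl ((abs_chainForce_sub_le ha0 ha1).trans ?_)).trans ?_
      · rw [← mul_sub, abs_mul, abs_of_nonneg ha0]
        linarith
      · rw [mul_pow, sq_abs, sq_abs]
        simp [hδ]
  refine (Finset.sum_le_sum h1).trans ?_
  rw [← Finset.mul_sum, Finset.sum_add_distrib, Finset.sum_add_distrib, ← Finset.mul_sum]
  have hδn : ∀ j, 0 ≤ δ j := fun j => sq_nonneg _
  have h2 : ∑ j ∈ Finset.range N, δ j ≤ ∑ j ∈ Finset.range N, δ (j + 1) := by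
    have e1 := Finset.sum_range_succ δ N
    have e2 := Finset.sum_range_succ' δ N
    linarith [hδn N]
  have h3 : (∑ j ∈ Finset.range N, if j + 1 < N then δ (j + 2) else 0) ≤
      ∑ j ∈ Finset.range N, δ (j + 1) := by
    have e := sum_mul_shift N (fun j => δ (j + 1)) (fun j => if j = 0 then 0 else 1) rfl
    simp only [Nat.add_eq_zero_iff, one_ne_zero, and_false, if_false, mul_one, add_assoc,
      Nat.reduceAdd] at e
    rw [← e]
    refine Finset.sum_le_sum fun j _ => ?_
    have := hδn (j + 1)
    split_ifs <;> simp [this]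
  have h4 : 0 ≤ ∑ j ∈ Finset.range N, δ (j + 1) := Finset.sum_nonneg fun j _ => hδn _
  change _ ≤ 600 ^ 2 * ∑ j ∈ Finset.range N, δ (j + 1)
  linarith

lemma isSmooth_chain (hσ : 0 ≤ σ) (ha0 : 0 ≤ a) (ha1 : a ≤ 1)
    (hu : Orthonormal ℝ (fun i : Fin N => u i)) : IsSmooth (600 * σ) (chain σ r a N p u) := by
  refine ⟨differentiable_chain, fun x x' => ?_⟩
  rw [gradient_chain, gradient_chain, ← smul_sub, ← Finset.sum_sub_distrib, norm_smul,
    Real.norm_of_nonneg hσ]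
  simp only [← sub_smul]
  have h1 := sum_chainCoeff_sub_sq_le (r := r) (N := N) ha0 ha1
    (z := coord r a p u x) (z' := coord r a p u x') rfl
  have h2 : ∑ j ∈ Finset.range N, (coord r a p u x (j + 1) - coord r a p u x' (j + 1)) ^ 2 ≤
      ‖x - x'‖ ^ 2 := by
    refine le_trans (le_of_eq ?_) (sum_inner_sq_le hu (x - x'))
    refine Finset.sum_congr rfl fun j _ => ?_
    simp only [coord, inner_sub_right]
    ring
  rw [← norm_sum_smul_sq hu] at h1
  have h3 := abs_le_of_sq_le_sq (h1.trans (by gcongr : _ ≤ 600 ^ 2 * ‖x - x'‖ ^ 2) |>.trans_eq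
    (mul_pow _ _ 2).symm) (by positivity)
  rw [abs_norm] at h3
  calc σ * _ ≤ σ * (600 * ‖x - x'‖) := by gcongr
    _ = _ := by ring

lemma chain_nonneg (hσ : 0 ≤ σ) (hr : 0 < r) (ha : 0 < a) (x : E d) :
    0 ≤ chain σ r a N p u x := by
  unfold chain
  have h1 : 0 ≤ ∑ j ∈ Finset.range N, (coord r a p u x (j + 1) - a * coord r a p u x j) ^ 2 / 2 :=
    Finset.sum_nonneg fun j _ => by positivity
  have h2 : 0 ≤ ∑ j ∈ Finset.range N, well (profile r a (j + 1)) (coord r a p u x (j + 1)) :=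
    Finset.sum_nonneg fun j _ => well_nonneg (profile_pos hr ha _) _
  positivity

lemma exists_chain_eq_zero (hu : Orthonormal ℝ (fun i : Fin N => u i)) :
    ∃ x, chain σ r a N p u x = 0 := by
  refine ⟨p + ∑ i : Fin N, (-profile r a (i + 1)) • u i, ?_⟩
  have h : ∀ j ≤ N, coord r a p u (p + ∑ i : Fin N, (-profile r a (i + 1)) • u i) j = 0 := by
    intro j hj
    cases j with
    | zero => rfl
    | succ j =>
      have := hu.inner_right_fintype (fun i : Fin N => -profile r a (i + 1)) ⟨j, hj⟩
      simp only [coord, add_sub_cancel_left]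
      simp only at this
      rw [this]; ring
  unfold chain
  rw [Finset.sum_eq_zero, Finset.sum_eq_zero]
  · simp
  · intro j hj
    rw [h _ (Finset.mem_range.mp hj), well_zero]
  · intro j hj
    rw [h _ (Finset.mem_range.mp hj), h _ (Finset.mem_range.mp hj).le]
    simp

lemma optValue_chain (hσ : 0 ≤ σ) (hr : 0 < r) (ha : 0 < a)
    (hu : Orthonormal ℝ (fun i : Fin N => u i)) : optValue (chain σ r a N p u) = 0 := by
  obtain ⟨x, hx⟩ := exists_chain_eq_zero (σ := σ) (r := r) (a := a) (p := p) hu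
  refine le_antisymm ?_ (le_ciInf fun y => chain_nonneg hσ hr ha y)
  rw [← hx]
  exact ciInf_le ⟨0, by rintro _ ⟨y, rfl⟩; exact chain_nonneg hσ hr ha y⟩ x

lemma sum_coord_sq_le (hr : 0 < r) (ha0 : 9 / 10 ≤ a) (ha1 : a < 1) (x : E d) :
    (1 - a ^ 2) * ∑ j ∈ Finset.range N, coord r a p u x (j + 1) ^ 2 ≤
      180 * ∑ j ∈ Finset.range N, chainCoeff r a N (coord r a p u x) j ^ 2 := by
  set z := coord r a p u x with hz
  -- Geometric continuation past `N` makes the missing right link of the last coordinate vanish, so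
  -- the forces agree with the gradient coefficients.
  set z' : ℕ → ℝ := fun j => if j ≤ N then z j else a ^ (j - N) * z N with hz'
  have h1 : ∀ j ≤ N, z' j = z j := fun j hj => if_pos hj
  have h2 : ∀ j, N ≤ j → z' (j + 1) = a * z' j := by
    intro j hj
    have e : z' j = a ^ (j - N) * z N := by
      rcases hj.eq_or_lt with rfl | hj
      · simp [hz']
      · exact if_neg (by omega)
    rw [e, hz']
    simp only
    rw [if_neg (by omega), Nat.succ_sub hj, pow_succ]
    ring
  have h := sum_sq_le_sum_chainForce ha0 ha1 (y := profile r a) (z := z') (N := N)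
    (profile_pos hr (by linarith)) (profile_succ r a) (by rw [h1 0 (Nat.zero_le _)]; rfl) h2
  have e1 : ∑ j ∈ Finset.range N, z' (j + 1) ^ 2 = ∑ j ∈ Finset.range N, z (j + 1) ^ 2 :=
    Finset.sum_congr rfl fun j hj => by rw [h1 _ (Finset.mem_range.mp hj)]
  have e2 : ∑ j ∈ Finset.range N,
      chainForce a (profile r a (j + 1)) (z' j) (z' (j + 1)) (z' (j + 2)) ^ 2 =
      ∑ j ∈ Finset.range N, chainCoeff r a N z j ^ 2 := by
    refine Finset.sum_congr rfl fun j hj => ?_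
    rw [Finset.mem_range] at hj
    unfold chainCoeff
    split_ifs with hj2
    · rw [h1 j hj.le, h1 (j + 1) hj, h1 (j + 2) hj2]
    · rw [h2 (j + 1) (by omega), h1 j hj.le, h1 (j + 1) hj]
  rwa [e1, e2] at h

lemma chain_le (hσ : 0 ≤ σ) (hr : 0 < r) (ha0 : 0 < a) (ha1 : a ≤ 1) (x : E d) :
    chain σ r a N p u x ≤ σ * (17 * ∑ j ∈ Finset.range N, coord r a p u x (j + 1) ^ 2) := by
  unfold chain
  set z := coord r a p u x with hz
  gcongr
  have ha2 : a ^ 2 ≤ 1 := by nlinarith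
  have h1 : ∑ j ∈ Finset.range N, (z (j + 1) - a * z j) ^ 2 / 2 ≤
      ∑ j ∈ Finset.range N, (z (j + 1) ^ 2 + z j ^ 2) := by
    refine Finset.sum_le_sum fun j _ => ?_
    nlinarith [sq_nonneg (z (j + 1) + a * z j), sq_nonneg (z j)]
  have h2 : ∑ j ∈ Finset.range N, well (profile r a (j + 1)) (z (j + 1)) ≤
      ∑ j ∈ Finset.range N, 15 * z (j + 1) ^ 2 :=
    Finset.sum_le_sum fun j _ => well_le (profile_pos hr ha0 _) _
  have h3 : ∑ j ∈ Finset.range N, z j ^ 2 ≤ ∑ j ∈ Finset.range N, z (j + 1) ^ 2 := by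
    have e1 := Finset.sum_range_succ (fun j => z j ^ 2) N
    have e2 := Finset.sum_range_succ' (fun j => z j ^ 2) N
    have e3 : z 0 = 0 := rfl
    simp only [e3] at e2
    nlinarith [sq_nonneg (z N)]
  rw [Finset.sum_add_distrib] at h1
  rw [← Finset.mul_sum] at h2
  linarith

lemma isPL_chain (hσ : 0 ≤ σ) (hr : 0 < r) (ha0 : 9 / 10 ≤ a) (ha1 : a < 1)
    (hu : Orthonormal ℝ (fun i : Fin N => u i)) :
    IsPL (σ * (1 - a ^ 2) / 6120) (chain σ r a N p u) := by
  intro x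
  rw [optValue_chain hσ hr (by linarith) hu, sub_zero, gradient_chain, norm_smul, mul_pow,
    norm_sum_smul_sq hu, Real.norm_of_nonneg hσ]
  have h1 := chain_le (N := N) (p := p) (u := u) hσ hr (by linarith) ha1.le x
  have h2 := sum_coord_sq_le (N := N) (p := p) (u := u) hr ha0 ha1 x
  have ha2 : 0 ≤ 1 - a ^ 2 := by nlinarith
  calc 2 * (σ * (1 - a ^ 2) / 6120) * chain σ r a N p u x
      ≤ 2 * (σ * (1 - a ^ 2) / 6120) *
        (σ * (17 * ∑ j ∈ Finset.range N, coord r a p u x (j + 1) ^ 2)) := by gcongr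
    _ = σ ^ 2 * (((1 - a ^ 2) * ∑ j ∈ Finset.range N, coord r a p u x (j + 1) ^ 2) / 180) := by
        ring
    _ ≤ _ := by gcongr; linarith

lemma coord_eq_profile {x : E d} {j : ℕ} (h : inner ℝ (u j) (x - p) = 0) :
    coord r a p u x (j + 1) = profile r a (j + 1) := by
  simp [coord, h]

lemma one_sub_sq_mul_sum_profile_sq (r a : ℝ) (k n : ℕ) :
    (1 - a ^ 2) * ∑ j ∈ Finset.Ico k (k + n), profile r a (j + 1) ^ 2 =
      r ^ 2 * a ^ 2 * ((a ^ 2) ^ k - (a ^ 2) ^ (k + n)) := by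
  induction n with
  | zero => simp
  | succ n ih =>
    rw [← add_assoc, Finset.sum_Ico_succ_top (by omega), mul_add, ih]
    unfold profile
    ring

/-- Only the first link is stretched at `p`, and the wells sum to a geometric series: `15 + 1 / 2 ≤
16`. -/
lemma chain_start_le (hσ : 0 ≤ σ) (hr : 0 < r) (ha0 : 0 < a) (ha1 : a < 1) :
    (1 - a ^ 2) * chain σ r a N p u p ≤ σ * (16 * r ^ 2) := by
  have hz : ∀ j, coord r a p u p (j + 1) = profile r a (j + 1) :=
    fun j => coord_eq_profile (by simp)
  unfold chain
  have ha2 : a ^ 2 ≤ 1 := by nlinarith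
  have h1 : ∑ j ∈ Finset.range N, (coord r a p u p (j + 1) - a * coord r a p u p j) ^ 2 / 2 ≤
      r ^ 2 / 2 := by
    rcases N with _ | N
    · simp; positivity
    · rw [Finset.sum_range_succ', Finset.sum_eq_zero, hz 0]
      · simp only [coord, profile, zero_add, pow_one, mul_zero, sub_zero]
        nlinarith [sq_nonneg r]
      · intro j _
        rw [hz, hz, profile_succ]; simp
  have h2 : ∑ j ∈ Finset.range N, well (profile r a (j + 1)) (coord r a p u p (j + 1)) ≤
      15 * ∑ j ∈ Finset.range N, profile r a (j + 1) ^ 2 := by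
    rw [Finset.mul_sum]
    refine Finset.sum_le_sum fun j _ => ?_
    rw [hz]
    exact well_le (profile_pos hr ha0 _) _
  have h3 := one_sub_sq_mul_sum_profile_sq r a 0 N
  rw [zero_add, pow_zero, ← Finset.range_eq_Ico] at h3
  have h4 : r ^ 2 * a ^ 2 * (1 - (a ^ 2) ^ N) ≤ r ^ 2 * 1 * 1 := by
    have : 0 ≤ (a ^ 2) ^ N := by positivity
    have : (a ^ 2) ^ N ≤ 1 := pow_le_one₀ (by positivity) ha2
    gcongr; linarith
  have h5 : (1 - a ^ 2) * ∑ j ∈ Finset.range N,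
      (coord r a p u p (j + 1) - a * coord r a p u p j) ^ 2 / 2 ≤ 1 * (r ^ 2 / 2) := by
    gcongr
    nlinarith
  have h6 := mul_le_mul_of_nonneg_left h2 (by nlinarith : 0 ≤ 1 - a ^ 2)
  rw [mul_left_comm]
  refine mul_le_mul_of_nonneg_left ?_ hσ
  rw [mul_add]
  nlinarith [sq_nonneg r]

lemma le_chain_of_orthogonal (hσ : 0 ≤ σ) (hr : 0 < r) (ha0 : 0 < a) (ha1 : a < 1) {m : ℕ}
    (hm : m ≤ N) {x : E d} (hx : ∀ j, m ≤ j → j < N → inner ℝ (u j) (x - p) = 0) :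
    σ * (12 * (r ^ 2 * a ^ 2 * ((a ^ 2) ^ m - (a ^ 2) ^ N))) ≤
      (1 - a ^ 2) * chain σ r a N p u x := by
  obtain ⟨n, rfl⟩ := Nat.exists_eq_add_of_le hm
  rw [← one_sub_sq_mul_sum_profile_sq, mul_left_comm 12, mul_left_comm]
  have ha2 : 0 ≤ 1 - a ^ 2 := by nlinarith
  gcongr
  unfold chain
  gcongr
  have h1 : 0 ≤ ∑ j ∈ Finset.range (m + n),
      (coord r a p u x (j + 1) - a * coord r a p u x j) ^ 2 / 2 :=
    Finset.sum_nonneg fun j _ => by positivity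
  have h2 : ∑ j ∈ Finset.Ico m (m + n), well (profile r a (j + 1)) (coord r a p u x (j + 1)) ≤
      ∑ j ∈ Finset.range (m + n), well (profile r a (j + 1)) (coord r a p u x (j + 1)) := by
    refine Finset.sum_le_sum_of_subset_of_nonneg ?_ fun j _ _ =>
      well_nonneg (profile_pos hr ha0 _) _
    intro j hj
    simp at hj ⊢
    omega
  have h3 : 12 * ∑ j ∈ Finset.Ico m (m + n), profile r a (j + 1) ^ 2 ≤
      ∑ j ∈ Finset.Ico m (m + n), well (profile r a (j + 1)) (coord r a p u x (j + 1)) := by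
    rw [Finset.mul_sum]
    refine Finset.sum_le_sum fun j hj => ?_
    rw [Finset.mem_Ico] at hj
    rw [coord_eq_profile (hx j hj.1 hj.2)]
    exact le_well_self (profile_pos hr ha0 _)
  linarith

/-- The gradient of a chain at a point that has moved only along the first `t` directions depends
only on the first `t + 1` directions. -/
lemma gradient_chain_congr (hr : 0 < r) (ha : 0 < a) {u' : ℕ → E d} {x : E d} {t : ℕ}
    (huu : ∀ j ≤ t, u' j = u j)
    (h : ∀ j, t ≤ j → j < N → inner ℝ (u j) (x - p) = 0)
    (h' : ∀ j, t ≤ j → j < N → inner ℝ (u' j) (x - p) = 0) :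
    gradient (chain σ r a N p u') x = gradient (chain σ r a N p u) x := by
  rw [gradient_chain, gradient_chain]
  congr 1
  have hc : ∀ j ≤ N, coord r a p u' x j = coord r a p u x j := by
    intro j hj
    cases j with
    | zero => rfl
    | succ j =>
      rcases le_total j t with h1 | h1
      · simp only [coord, huu j h1]
      · rw [coord_eq_profile (h j h1 hj), coord_eq_profile (h' j h1 hj)]
  refine Finset.sum_congr rfl fun j hj => ?_
  rw [Finset.mem_range] at hj
  have hcc : chainCoeff r a N (coord r a p u' x) j = chainCoeff r a N (coord r a p u x) j := by
    unfold chainCoeff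
    rw [hc j hj.le, hc (j + 1) hj]
    split_ifs with h2
    · rw [hc (j + 2) h2]
    · rfl
  rw [hcc]
  rcases le_or_gt j t with h1 | h1
  · rw [huu j h1]
  -- Beyond `t` the coordinate and its neighbours sit on the profile: both links are relaxed and the
  -- well is at its second critical point.
  · have h0 : chainCoeff r a N (coord r a p u x) j = 0 := by
      obtain ⟨k, rfl⟩ : ∃ k, j = k + 1 := ⟨j - 1, by omega⟩
      unfold chainCoeff chainForce
      rw [coord_eq_profile (h k (by omega) (by omega)), coord_eq_profile (h (k + 1) h1.le hj),
        wellDeriv_self (profile_pos hr ha _)]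
      split_ifs with h2
      · rw [coord_eq_profile (h (k + 2) (by omega) h2), profile_succ r a (k + 2),
          profile_succ r a (k + 1)]
        ring
      · rw [profile_succ r a (k + 1)]; ring
    rw [h0, zero_smul, zero_smul]

end

/-! ### The resisting oracle. -/

lemma exists_orthonormal_orthogonal {d N : ℕ} (X : Submodule ℝ (E d))
    (h : Module.finrank ℝ X + N ≤ d) :
    ∃ e : ℕ → E d, Orthonormal ℝ (fun i : Fin N => e i) ∧
      ∀ j < N, ∀ x ∈ X, inner ℝ (e j) x = 0 := by
  have hr := X.finrank_add_finrank_orthogonal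
  rw [finrank_euclideanSpace_fin] at hr
  have hN : N ≤ Module.finrank ℝ Xᗮ := by omega
  let b := stdOrthonormalBasis ℝ Xᗮ
  refine ⟨fun j => if h : j < Module.finrank ℝ Xᗮ then (b ⟨j, h⟩ : E d) else 0, ?_, ?_⟩
  · have h1 : Orthonormal ℝ (fun i : Fin N => ((b (Fin.castLE hN i) : Xᗮ) : E d)) :=
      (b.orthonormal.comp_linearIsometry Xᗮ.subtypeₗᵢ).comp _ (Fin.castLE_injective hN)
    convert h1 using 2 with i
    exact dif_pos (i.2.trans_le hN)
  · intro j hj x hx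
    simp only
    rw [dif_pos (hj.trans_le hN)]
    exact Submodule.inner_left_of_mem_orthogonal hx (b _).2

/-- Against any first-order algorithm, the directions of a chain can be chosen so that the
algorithm finds at most one of them in each step. -/
lemma exists_resisting_directions {x₀ : (d : ℕ) → E d} {A : Algorithm} (hA : A ∈ firstOrder x₀)
    {σ r a : ℝ} (hr : 0 < r) (ha : 0 < a) {d N : ℕ} (hd : 3 * N + 1 ≤ d) (n : ℕ) (hn : n ≤ N) :
    ∃ u : ℕ → E d, Orthonormal ℝ (fun i : Fin N => u i) ∧
      ∀ t ≤ n, ∀ j, t ≤ j → j < N →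
        inner ℝ (u j) (A d (chain σ r a N (x₀ d) u) t - x₀ d) = 0 := by
  obtain ⟨step, hstep⟩ := hA
  induction n with
  | zero =>
    obtain ⟨u, hu, -⟩ := exists_orthonormal_orthogonal (d := d) (N := N) ⊥
      (by rw [finrank_bot]; omega)
    refine ⟨u, hu, fun t ht j _ _ => ?_⟩
    rw [Nat.le_zero.mp ht, (hstep d _ differentiable_chain).1, sub_self, inner_zero_right]
  | succ n ih =>
    obtain ⟨u, hu, h⟩ := ih (by omega)
    set f := chain σ r a N (x₀ d) u with hf
    classical
    let s : Finset (E d) := (Finset.range (n + 2)).image (fun t => A d f t - x₀ d) ∪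
      (Finset.range (n + 1)).image u
    -- There are `n + 2` iterates and `n + 1` directions, with `n + 1 ≤ N`; adding `N` fresh
    -- directions explains the dimension `3 * N + 1`.
    have hs : s.card ≤ 2 * N + 1 := by
      have h1 := Finset.card_union_le ((Finset.range (n + 2)).image (fun t => A d f t - x₀ d))
        ((Finset.range (n + 1)).image u)
      have h2 := Finset.card_image_le (s := Finset.range (n + 2)) (f := fun t => A d f t - x₀ d)
      have h3 := Finset.card_image_le (s := Finset.range (n + 1)) (f := u)
      rw [Finset.card_range] at h2 h3
      refine h1.trans ?_
      omega
    obtain ⟨e, he, hX⟩ := exists_orthonormal_orthogonal (N := N)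
      (Submodule.span ℝ (s : Set (E d)))
      (by
        have : Module.finrank ℝ (Submodule.span ℝ (s : Set (E d))) ≤ s.card :=
          finrank_span_finset_le_card s
        omega)
    have heA : ∀ j < N, ∀ t ≤ n + 1, inner ℝ (e j) (A d f t - x₀ d) = 0 := by
      intro j hj t ht
      refine hX j hj _ (Submodule.subset_span ?_)
      exact Finset.mem_coe.mpr (Finset.mem_union_left _
        (Finset.mem_image_of_mem _ (Finset.mem_range.mpr (by omega))))
    have heu : ∀ j < N, ∀ i ≤ n, inner ℝ (e j) (u i) = 0 := by
      intro j hj i hi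
      refine hX j hj _ (Submodule.subset_span ?_)
      exact Finset.mem_coe.mpr (Finset.mem_union_right _
        (Finset.mem_image_of_mem _ (Finset.mem_range.mpr (by omega))))
    let u' : ℕ → E d := fun j => if j ≤ n then u j else e j
    have hu'1 : ∀ j ≤ n, u' j = u j := fun j hj => if_pos hj
    have hu'2 : ∀ j, ¬ j ≤ n → u' j = e j := fun j hj => if_neg hj
    have hu' : Orthonormal ℝ (fun i : Fin N => u' i) := by
      rw [orthonormal_iff_ite] at hu he ⊢
      intro i j
      by_cases hi : (i : ℕ) ≤ n <;> by_cases hj : (j : ℕ) ≤ n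
      · rw [hu'1 _ hi, hu'1 _ hj]; exact hu i j
      · rw [hu'1 _ hi, hu'2 _ hj, real_inner_comm, heu _ j.2 _ hi, if_neg]
        rintro rfl; exact hj hi
      · rw [hu'2 _ hi, hu'1 _ hj, heu _ i.2 _ hj, if_neg]
        rintro rfl; exact hi hj
      · rw [hu'2 _ hi, hu'2 _ hj]; exact he i j
    have horth : ∀ t ≤ n + 1, ∀ j, t ≤ j → j < N → inner ℝ (u' j) (A d f t - x₀ d) = 0 := by
      intro t ht j hj hjN
      by_cases hjn : j ≤ n
      · rw [hu'1 j hjn]; exact h t (by omega) j hj hjN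
      · rw [hu'2 j hjn]; exact heA j hjN t ht
    -- The first `n + 1` directions are kept, so the gradients at iterates `0, …, n` are unchanged,
    -- and with them the run up to iterate `n + 1`.
    have hsame : ∀ t ≤ n + 1, A d (chain σ r a N (x₀ d) u') t = A d f t := by
      intro t
      induction t using Nat.strong_induction_on with
      | _ t iht =>
        intro ht
        cases t with
        | zero => rw [(hstep d _ differentiable_chain).1, (hstep d f differentiable_chain).1]
        | succ t =>
          rw [(hstep d _ differentiable_chain).2, (hstep d f differentiable_chain).2]
          congr 1
          funext j
          have hj := j.2
          rw [iht j hj (by omega),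
            gradient_chain_congr (t := j) hr ha (fun i hi => hu'1 i (by omega))
              (fun i hi hiN => h j (by omega) i hi hiN)
              (fun i hi hiN => horth j (by omega) i hi hiN)]
    refine ⟨u', hu', fun t ht j hj hjN => ?_⟩
    rw [hsame t ht]
    exact horth t ht j hj hjN

/-! ### Choice of parameters for the lower bound. -/

lemma complexity_le {ε : ℝ} {A : Algorithm} {d : ℕ} {f : E d → ℝ} {t : ℕ}
    (h : f (A d f t) - optValue f ≤ ε) : complexity ε A f ≤ t :=
  iInf₂_le t h

lemma le_complexity {ε : ℝ} {A : Algorithm} {d : ℕ} {f : E d → ℝ} {m : ℕ}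
    (h : ∀ t < m, ε < f (A d f t) - optValue f) : (m : ℕ∞) ≤ complexity ε A f := by
  refine le_iInf₂ fun t ht => ?_
  by_contra hlt
  exact absurd (h t (by exact_mod_cast not_le.mp hlt)) (not_lt.mpr ht)

lemma one_le_log_div {Δ ε : ℝ} (hε : 0 < ε) (h : ε ≤ Δ / 16) : 1 ≤ Real.log (Δ / ε) := by
  rw [Real.le_log_iff_exp_le (by apply div_pos <;> linarith), le_div_iff₀ hε]
  have := Real.exp_one_lt_d9
  nlinarith

lemma exp_neg_two_mul_le {θ : ℝ} (h0 : 0 ≤ θ) (h1 : θ ≤ 1 / 2) :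
    Real.exp (-(2 * θ)) ≤ 1 - θ := by
  have h := Real.add_one_le_exp (2 * θ)
  rw [Real.exp_neg, inv_le_comm₀ (Real.exp_pos _) (by linarith)]
  refine le_trans ?_ h
  rw [inv_le_iff_one_le_mul₀ (by linarith)]
  nlinarith

theorem exists_le_worstComplexity {L μ Δ ε : ℝ} {x₀ : (d : ℕ) → E d} {A : Algorithm}
    (hA : A ∈ firstOrder x₀) (hμ : 0 < μ) (hκ : 10 ^ 8 ≤ L / μ) (hε : 0 < ε) (hΔ : ε ≤ Δ / 16) :
    ∃ m : ℕ, 1 / 10 ^ 8 * (L / μ * Real.log (Δ / ε)) ≤ m ∧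
      (m : ℕ∞) ≤ worstComplexity ε A (plClass x₀ Δ μ L) := by
  have hq := one_le_log_div hε hΔ
  set q := Real.log (Δ / ε) with hqdef
  set κ := L / μ with hκdef
  have hκ0 : 0 < κ := by linarith
  have hΔ0 : 0 < Δ := by linarith
  have hL : L = κ * μ := by rw [hκdef]; field_simp
  have hL0 : 0 < L := by rw [hL]; positivity
  set m := ⌈1 / 10 ^ 8 * (κ * q)⌉₊ with hm
  refine ⟨m, Nat.le_ceil _, ?_⟩
  have hκq : 10 ^ 8 ≤ κ * q := by nlinarith
  have hm2 : (m : ℝ) ≤ 2 / 10 ^ 8 * (κ * q) := by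
    have := (Nat.ceil_lt_add_one (by positivity : 0 ≤ 1 / 10 ^ 8 * (κ * q))).le
    rw [← hm] at this
    linarith
  -- `3672000 = 600 * 6120`: with `σ = L / 600` and `1 - a ^ 2 = θ` the PL constant is exactly `μ`.
  set θ := 3672000 / κ with hθ
  have hθ0 : 0 < θ := by positivity
  have hθκ : θ * κ = 3672000 := by rw [hθ]; field_simp
  have hθ1 : θ ≤ 1 / 10 := by
    rw [hθ, div_le_iff₀ hκ0]; linarith
  -- `m` is small enough that `(1 - θ) ^ m` is at least the square root of `ε / Δ`, which exceeds `4
  -- * (ε / Δ)` because `ε / Δ ≤ 1 / 16`.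
  have hpow : 4 * (ε / Δ) ≤ (1 - θ) ^ m := by
    have h1 : Real.exp (-(2 * θ)) ^ m ≤ (1 - θ) ^ m := by
      gcongr
      exact exp_neg_two_mul_le hθ0.le (by linarith)
    have h2 : Real.exp (-(q / 2)) ≤ Real.exp (-(2 * θ)) ^ m := by
      rw [← Real.exp_nat_mul]
      apply Real.exp_le_exp.mpr
      have : θ * m ≤ θ * (2 / 10 ^ 8 * (κ * q)) := by gcongr
      have e : θ * (2 / 10 ^ 8 * (κ * q)) = 2 / 10 ^ 8 * (3672000 * q) := by rw [← hθκ]; ring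
      linarith
    have h3 : Real.exp (-(q / 2)) ^ 2 = ε / Δ := by
      rw [← Real.exp_nat_mul]
      rw [show ((2 : ℕ) : ℝ) * -(q / 2) = -q by push_cast; ring, Real.exp_neg, hqdef,
        Real.exp_log (by positivity), inv_div]
    have h4 : ε / Δ ≤ 1 / 16 := by rw [div_le_iff₀ hΔ0]; linarith
    have h5 := Real.exp_pos (-(q / 2))
    have h6 : Real.exp (-(q / 2)) ≤ 1 / 4 := by
      refine le_of_sq_le_sq ?_ (by norm_num)
      rw [h3]; norm_num; linarith
    nlinarith
  have hεΔ : 0 < ε / Δ := by positivity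
  -- The chain is long enough that its truncated tail costs less than one of the four units of `ε /
  -- Δ`.
  obtain ⟨N, hN⟩ := exists_pow_lt_of_lt_one hεΔ (by linarith : 1 - θ < 1)
  have hmN : m ≤ N := by
    by_contra hlt
    have := pow_le_pow_of_le_one (by linarith : 0 ≤ 1 - θ) (by linarith) (not_le.mp hlt).le
    linarith
  set a := Real.sqrt (1 - θ) with ha
  have ha2 : a ^ 2 = 1 - θ := Real.sq_sqrt (by linarith)
  have ha0 : 9 / 10 ≤ a := Real.le_sqrt_of_sq_le (by norm_num; linarith)
  have ha1 : a < 1 := by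
    rw [ha, Real.sqrt_lt' one_pos]; linarith
  have hap : 0 < a := by linarith
  set σ := L / 600 with hσ
  have hσ0 : 0 < σ := by positivity
  -- Scaled so that the bound on the initial gap is exactly `Δ`.
  set r := Real.sqrt (Δ * θ / (16 * σ)) with hr
  have hr0 : 0 < r := Real.sqrt_pos.mpr (by positivity)
  have hr2 : σ * (16 * r ^ 2) = Δ * θ := by
    rw [hr, Real.sq_sqrt (by positivity)]; field_simp
  obtain ⟨d, hd⟩ : ∃ d, 3 * N + 1 ≤ d := ⟨_, le_rfl⟩
  obtain ⟨u, hu, horth⟩ := exists_resisting_directions hA (σ := σ) hr0 hap hd m hmN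
  set f := chain σ r a N (x₀ d) u with hf
  have hopt : optValue f = 0 := optValue_chain hσ0.le hr0 hap hu
  have hmem : f ∈ plClass x₀ Δ μ L d := by
    refine ⟨?_, ?_, ?_, ?_⟩
    · have := isSmooth_chain (r := r) (p := x₀ d) hσ0.le hap.le ha1.le hu
      rwa [show 600 * σ = L by rw [hσ]; ring] at this
    · have := isPL_chain (p := x₀ d) hσ0.le hr0 ha0 ha1 hu
      rwa [show σ * (1 - a ^ 2) / 6120 = μ by
        rw [ha2, hσ, hL, sub_sub_cancel]; linear_combination μ * hθκ / 3672000] at this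
    · obtain ⟨z, hz⟩ := exists_chain_eq_zero (σ := σ) (r := r) (a := a) (p := x₀ d) hu
      exact ⟨z, fun y => hz.le.trans (chain_nonneg hσ0.le hr0 hap y)⟩
    · have := chain_start_le (N := N) (p := x₀ d) (u := u) hσ0.le hr0 hap ha1
      rw [hr2, ha2, sub_sub_cancel, mul_comm Δ] at this
      rw [hopt, sub_zero]
      exact le_of_mul_le_mul_left this hθ0
  refine le_trans ?_ (le_iSup_of_le d (le_iSup₂_of_le f hmem le_rfl))
  refine le_complexity fun t ht => ?_
  rw [hopt, sub_zero]
  have h1 := le_chain_of_orthogonal (p := x₀ d) (u := u) hσ0.le hr0 hap ha1 hmN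
    (x := A d f t) (fun j hj hjN => horth t ht.le j (by omega) hjN)
  rw [ha2, sub_sub_cancel] at h1
  have h2 : 3 * (ε / Δ) ≤ (1 - θ) ^ m - (1 - θ) ^ N := by linarith
  have h3 : Δ * θ * (12 / 16 * ((9 / 10) * (3 * (ε / Δ)))) ≤
      Δ * θ * (12 / 16 * ((1 - θ) * ((1 - θ) ^ m - (1 - θ) ^ N))) := by
    have h0 : 9 / 10 ≤ 1 - θ := by linarith
    gcongr
  have h4 : Δ * θ * (12 / 16 * ((9 / 10) * (3 * (ε / Δ)))) = θ * (81 / 40 * ε) := by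
    field_simp; norm_num
  have h5 : θ * (81 / 40 * ε) ≤ θ * f (A d f t) := by
    rw [← h4]
    refine h3.trans (le_trans (le_of_eq ?_) h1)
    rw [← hr2]; ring
  have h6 := le_of_mul_le_mul_left h5 hθ0
  linarith

/-! ### Gradient descent. -/

lemma IsSmooth.apply_gradient_step_le {d : ℕ} {L : ℝ} (hL : 0 < L) {f : E d → ℝ}
    (hf : IsSmooth L f) (x : E d) :
    f (x - (1 / L) • gradient f x) ≤ f x - ‖gradient f x‖ ^ 2 / (2 * L) := by
  set g := gradient f x with hg
  -- By Cauchy–Schwarz and the Lipschitz gradient, `h` has nonpositive derivative for `t > 0`; the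
  -- claim is `h (1 / L) ≤ h 0`.
  let h : ℝ → ℝ := fun t => f (x - t • g) + t * ‖g‖ ^ 2 - L * ‖g‖ ^ 2 * t ^ 2 / 2
  have hder : ∀ t, HasDerivAt h (-inner ℝ (gradient f (x - t • g)) g + ‖g‖ ^ 2 -
      L * ‖g‖ ^ 2 * t) t := by
    intro t
    have h1 : HasDerivAt (fun t : ℝ => x - t • g) (-g) t := by
      simpa using ((hasDerivAt_id t).smul_const g).const_sub x
    have h2 := ((hf.1 (x - t • g)).hasGradientAt.hasFDerivAt).comp_hasDerivAt t h1
    have h3 : HasDerivAt (fun t : ℝ => f (x - t • g)) (-inner ℝ (gradient f (x - t • g)) g) t := by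
      refine h2.congr_deriv ?_
      rw [InnerProductSpace.toDual_apply_apply, inner_neg_right]
    refine ((h3.add ((hasDerivAt_id t).mul_const (‖g‖ ^ 2))).sub
      ((((hasDerivAt_id t).pow 2).const_mul (L * ‖g‖ ^ 2)).div_const 2)).congr_deriv ?_
    simp
    ring
  have hanti : AntitoneOn h (Set.Ici 0) := by
    refine antitoneOn_of_deriv_nonpos (convex_Ici 0)
      (fun t _ => (hder t).continuousAt.continuousWithinAt)
      (fun t _ => (hder t).differentiableAt.differentiableWithinAt) fun t ht => ?_
    rw [interior_Ici, Set.mem_Ioi] at ht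
    rw [(hder t).deriv]
    have h1 : ‖g - gradient f (x - t • g)‖ ≤ L * (t * ‖g‖) := by
      refine (hf.2 x (x - t • g)).trans_eq ?_
      rw [sub_sub_cancel, norm_smul, Real.norm_of_nonneg ht.le]
    have h2 := real_inner_le_norm (g - gradient f (x - t • g)) g
    rw [inner_sub_left, real_inner_self_eq_norm_sq] at h2
    have h3 : ‖g - gradient f (x - t • g)‖ * ‖g‖ ≤ L * (t * ‖g‖) * ‖g‖ := by gcongr
    nlinarith
  have h01 := hanti (Set.mem_Ici.mpr le_rfl) (Set.mem_Ici.mpr (by positivity : 0 ≤ 1 / L))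
    (by positivity)
  simp only [h, zero_smul, sub_zero, zero_mul, add_zero, zero_pow two_ne_zero, mul_zero,
    zero_div] at h01
  have e : L * ‖g‖ ^ 2 * (1 / L) ^ 2 / 2 = ‖g‖ ^ 2 / (2 * L) := by field_simp
  have e2 : 1 / L * ‖g‖ ^ 2 = 2 * (‖g‖ ^ 2 / (2 * L)) := by field_simp
  rw [e, e2] at h01
  linarith

lemma gradientDescent_mem_firstOrder (x₀ : (d : ℕ) → E d) (L : ℝ) :
    gradientDescent x₀ L ∈ firstOrder x₀ :=
  ⟨fun _ n v => (v (Fin.last n)).1 - (1 / L) • (v (Fin.last n)).2,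
    fun _ _ _ => ⟨rfl, fun _ => rfl⟩⟩

lemma gradientDescent_gap_le {L μ Δ : ℝ} {x₀ : (d : ℕ) → E d} (hL : 0 < L) (hμ : μ ≤ L)
    {d : ℕ} {f : E d → ℝ} (hf : f ∈ plClass x₀ Δ μ L d) (t : ℕ) :
    f (gradientDescent x₀ L d f t) - optValue f ≤ (1 - μ / L) ^ t * Δ := by
  obtain ⟨hs, hpl, -, h0⟩ := hf
  have h1 : 0 ≤ 1 - μ / L := by rw [sub_nonneg, div_le_one hL]; exact hμ
  induction t with
  | zero => simpa [gradientDescent] using h0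
  | succ t ih =>
    set x := gradientDescent x₀ L d f t with hx
    have h2 := hs.apply_gradient_step_le hL x
    have h3 := hpl x
    have h4 : μ / L * (f x - optValue f) ≤ ‖gradient f x‖ ^ 2 / (2 * L) := by
      rw [le_div_iff₀ (by positivity)]
      refine le_trans (le_of_eq ?_) h3
      field_simp
    calc f (x - (1 / L) • gradient f x) - optValue f
        ≤ (1 - μ / L) * (f x - optValue f) := by linarith
      _ ≤ (1 - μ / L) * ((1 - μ / L) ^ t * Δ) := by gcongr
      _ = _ := by ring

theorem worstComplexity_gradientDescent_le {L μ Δ ε : ℝ} {x₀ : (d : ℕ) → E d}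
    (hμ : 0 < μ) (hκ : 1 ≤ L / μ) (hε : 0 < ε) (hΔ : ε ≤ Δ / 16) :
    (worstComplexity ε (gradientDescent x₀ L) (plClass x₀ Δ μ L) : ℝ≥0∞) ≤
      ENNReal.ofReal (2 * (L / μ * Real.log (Δ / ε))) := by
  have hq := one_le_log_div hε hΔ
  set q := Real.log (Δ / ε) with hqdef
  have hΔ0 : 0 < Δ := by linarith
  have hμL : μ ≤ L := by rwa [one_le_div hμ] at hκ
  have hL : 0 < L := by linarith
  set m := ⌈L / μ * q⌉₊ with hm
  have hκq : 1 ≤ L / μ * q := by nlinarith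
  have hm1 : L / μ * q ≤ m := Nat.le_ceil _
  have hm2 : (m : ℝ) ≤ 2 * (L / μ * q) := by
    have := (Nat.ceil_lt_add_one (by positivity : 0 ≤ L / μ * q)).le
    linarith
  have hw : worstComplexity ε (gradientDescent x₀ L) (plClass x₀ Δ μ L) ≤ m := by
    refine iSup_le fun d => iSup₂_le fun f hf => complexity_le ?_
    refine (gradientDescent_gap_le hL hμL hf m).trans ?_
    have h1 : (1 - μ / L) ^ m ≤ Real.exp (-(μ / L)) ^ m := by
      gcongr
      · rw [sub_nonneg, div_le_one hL]; exact hμL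
      · linarith [Real.add_one_le_exp (-(μ / L))]
    have h2 : Real.exp (-(μ / L)) ^ m ≤ ε / Δ := by
      rw [← Real.exp_nat_mul, ← Real.le_log_iff_exp_le (by positivity),
        ← inv_div Δ ε, Real.log_inv, ← hqdef]
      have h3 : μ / L * (L / μ * q) ≤ μ / L * m := by gcongr
      have h4 : μ / L * (L / μ * q) = q := by field_simp
      linarith
    calc (1 - μ / L) ^ m * Δ ≤ ε / Δ * Δ := by gcongr; exact h1.trans h2
      _ = ε := by field_simp
  calc (worstComplexity ε (gradientDescent x₀ L) (plClass x₀ Δ μ L) : ℝ≥0∞)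
      ≤ ((m : ℕ∞) : ℝ≥0∞) := ENat.toENNReal_mono hw
    _ = ENNReal.ofReal (m : ℝ) := by simp
    _ ≤ _ := ENNReal.ofReal_le_ofReal hm2

/-! ### The minimax bounds. -/

theorem le_minimaxComplexity {L μ Δ ε : ℝ} (x₀ : (d : ℕ) → E d) (hμ : 0 < μ)
    (hκ : 10 ^ 8 ≤ L / μ) (hε : 0 < ε) (hΔ : ε ≤ Δ / 16) :
    ENNReal.ofReal (1 / 10 ^ 8 * (L / μ * Real.log (Δ / ε))) ≤
      (minimaxComplexity ε (firstOrder x₀) (plClass x₀ Δ μ L) : ℝ≥0∞) := by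
  have h : ((⌈1 / 10 ^ 8 * (L / μ * Real.log (Δ / ε))⌉₊ : ℕ) : ℕ∞) ≤
      minimaxComplexity ε (firstOrder x₀) (plClass x₀ Δ μ L) := by
    refine le_iInf₂ fun A hA => ?_
    obtain ⟨m, hm, hle⟩ := exists_le_worstComplexity hA hμ hκ hε hΔ
    exact le_trans (by exact_mod_cast Nat.ceil_le.mpr hm) hle
  refine le_trans ?_ (ENat.toENNReal_mono h)
  rw [ENat.toENNReal_coe]
  exact (ENNReal.ofReal_le_ofReal (Nat.le_ceil _)).trans_eq (ENNReal.ofReal_natCast _)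

end PLBound

theorem theorem3 :
    ∃ K : ℝ, 1 ≤ K ∧
      (∃ c C : ℝ, 0 < c ∧ 0 < C ∧
        ∀ (L μ Δ ε : ℝ) (x₀ : (d : ℕ) → PLBound.E d),
          0 < μ → K ≤ L / μ → 0 < ε → ε ≤ Δ / 16 →
          ENNReal.ofReal (c * (L / μ * Real.log (Δ / ε))) ≤
              (PLBound.minimaxComplexity ε (PLBound.firstOrder x₀)
                (PLBound.plClass x₀ Δ μ L) : ℝ≥0∞) ∧
          PLBound.gradientDescent x₀ L ∈ PLBound.firstOrder x₀ ∧
          (PLBound.worstComplexity ε (PLBound.gradientDescent x₀ L)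
                (PLBound.plClass x₀ Δ μ L) : ℝ≥0∞) ≤
              ENNReal.ofReal (C * (L / μ * Real.log (Δ / ε))) ∧
          (PLBound.worstComplexity ε (PLBound.gradientDescent x₀ L)
                (PLBound.plClass x₀ Δ μ L) : ℝ≥0∞) ≤
              ENNReal.ofReal C *
                (PLBound.minimaxComplexity ε (PLBound.firstOrder x₀)
                  (PLBound.plClass x₀ Δ μ L) : ℝ≥0∞)) ∧
      (∀ Δ : ℝ, 0 < Δ → ∃ c : ℝ, 0 < c ∧
        ∀ (L μ ε : ℝ) (x₀ : (d : ℕ) → PLBound.E d),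
          0 < μ → K ≤ L / μ → 0 < ε → ε ≤ Δ / 16 →
          ENNReal.ofReal (c * (L / μ * Real.log (1 / ε))) ≤
            (PLBound.minimaxComplexity ε (PLBound.firstOrder x₀)
              (PLBound.plClass x₀ Δ μ L) : ℝ≥0∞)) := by
  refine ⟨10 ^ 8, by norm_num, ⟨1 / 10 ^ 8, 2 * 10 ^ 8, by norm_num, by norm_num, ?_⟩, ?_⟩
  · intro L μ Δ ε x₀ hμ hκ hε hΔ
    have hq := PLBound.one_le_log_div hε hΔ
    have hκ0 : (0 : ℝ) ≤ L / μ := le_trans (by norm_num) hκ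
    have hlow := PLBound.le_minimaxComplexity x₀ hμ hκ hε hΔ
    have hup := PLBound.worstComplexity_gradientDescent_le (x₀ := x₀) hμ
      (le_trans (by norm_num) hκ) hε hΔ
    refine ⟨hlow, PLBound.gradientDescent_mem_firstOrder x₀ L, hup.trans ?_, hup.trans ?_⟩
    · apply ENNReal.ofReal_le_ofReal
      gcongr
      norm_num
    · calc ENNReal.ofReal (2 * (L / μ * Real.log (Δ / ε)))
          = ENNReal.ofReal (2 * 10 ^ 8) *
            ENNReal.ofReal (1 / 10 ^ 8 * (L / μ * Real.log (Δ / ε))) := by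
            rw [← ENNReal.ofReal_mul (by norm_num)]
            congr 1
            ring
        _ ≤ _ := by gcongr
  · intro Δ hΔ0
    have hM : 0 < 1 + |Real.log Δ| := by positivity
    refine ⟨1 / 10 ^ 8 / (1 + |Real.log Δ|), by positivity, ?_⟩
    intro L μ ε x₀ hμ hκ hε hΔ
    have hq := PLBound.one_le_log_div hε hΔ
    have hκ0 : (0 : ℝ) ≤ L / μ := le_trans (by norm_num) hκ
    refine le_trans (ENNReal.ofReal_le_ofReal ?_) (PLBound.le_minimaxComplexity x₀ hμ hκ hε hΔ)
    -- Since `log (Δ / ε) ≥ 1`, the shift by `log Δ` is absorbed into a factor.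
    have h1 : Real.log (1 / ε) ≤ (1 + |Real.log Δ|) * Real.log (Δ / ε) := by
      have e : Real.log (1 / ε) = Real.log (Δ / ε) - Real.log Δ := by
        rw [Real.log_div hΔ0.ne' hε.ne', Real.log_div one_ne_zero hε.ne', Real.log_one]
        ring
      rw [e]
      nlinarith [neg_abs_le (Real.log Δ), abs_nonneg (Real.log Δ)]
    calc 1 / 10 ^ 8 / (1 + |Real.log Δ|) * (L / μ * Real.log (1 / ε))
        ≤ 1 / 10 ^ 8 / (1 + |Real.log Δ|) *
          (L / μ * ((1 + |Real.log Δ|) * Real.log (Δ / ε))) := by gcongr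
      _ = 1 / 10 ^ 8 * (L / μ * Real.log (Δ / ε)) := by field_simp
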